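/- Let $M=\langle\mathcal S,\mathcal A,P,r,\gamma\rangle$ be a countable discounted Markov decision process: $\mathcal S,\mathcal A$ are countable sets, $P(\cdot\mid s,a)$ is a probability distribution on $\mathcal S$ for every $(s,a)\in\mathcal S\times\mathcal A$, $r:\mathcal S\times\mathcal A\to\mathbb R$ is bounded, and $\gamma\in[0,1)$. Let $\Omega=(\mathcal S\times\mathcal A\times\mathcal S)^{\mathbb N_0}$ carry the product of the discrete $\sigma$-algebras, write $\omega=((S_t,A_t,S'_t)(\omega))_{t\in\mathbb N_0}$ for $\omega\in\Omega$, and put $\mathcal T_{(s,a)}(\omega)=\{t\in\mathbb N_0:(S_t,A_t)(\omega)=(s,a)\}$. Let $\mathbb P$ be a probability measure on $\Omega$ such that, for all $t\in\mathbb N_0$ and $s'\in\mathcal S$, almost surely $$\mathbb P(S'_t=s'\mid S_0,A_0,S'_0,\dots,S_{t-1},A_{t-1},S'_{t-1},S_t,A_t)=P(s'\mid S_t,A_t).$$ Let $\alpha=(\alpha_t)_{t\in\mathbb N_0}$ be a sequence in $[0,1]$, and suppose that $(\mathbb P,\alpha)$ satisfies the Robbins--Monro condition: for all $(s,a)\in\mathcal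 S\times\mathcal A$ and $\mathbb P$-almost all $\omega$, $$\sum_{t\in\mathcal T_{(s,a)}(\omega)}\alpha_t=\infty\quad\text{and}\quad\sum_{t\in\mathcal T_{(s,a)}(\omega)}\alpha_t^2<\infty .$$ For $\omega\in\Omega$, the action-replay process of $M$ induced by $\alpha$ and $\omega$ is the Markov decision process $\langle\hat{\mathcal S},\mathcal A,\hat P(\omega),\hat r(\omega),\gamma\rangle$ with $\hat{\mathcal S}=(\mathcal S\times\mathbb N_0)\cup\{s_{\mathrm{absorb}}\}$ (where $s_{\mathrm{absorb}}\notin\mathcal S\times\mathbb N_0$) and, for $(s,a)\in\mathcal S\times\mathcal A$, $t\in\mathbb N_0$ and $t'\in\mathcal T_{(s,a)}(\omega)\cap[0,t)$, $$\hat P((S'_{t'}(\omega),t')\mid(s,t),a;\omega)=\alpha_{t'}\prod_{\tau\in\mathcal T_{(s,a)}(\omega)\cap(t',t)}(1-\alpha_\tau),$$ $$\hat P(s_{\mathrm{absorb}}\mid(s,t),a;\omega)=\prod_{\tau\in\mathcal T_{(s,a)}(\omega)\cap[0,t)}(1-\alpha_\tau),\qquad \hat P(s_{\mathrm{absorb}}\mid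 s_{\mathrm{absorb}},a;\omega)=1,$$ all other transition probabilities being $0$, and with rewards $$\hat r((s,t),a;\omega)=r(s,a)\sum_{t'\in\mathcal T_{(s,a)}(\omega)\cap[0,t)}\hat P((S'_{t'}(\omega),t')\mid(s,t),a;\omega),\qquad \hat r(s_{\mathrm{absorb}},a;\omega)=0.$$ Then, for $\mathbb P$-almost every $\omega\in\Omega$ and every $(s,a,s')\in\mathcal S\times\mathcal A\times\mathcal S$, $$\hat r((s,t),a;\omega)\xrightarrow{t\to\infty}r(s,a)\qquad\text{and}\qquad\sum_{t'\in\mathcal T_{(s,a)}(\omega)\cap[0,t)}\hat P((s',t')\mid(s,t),a;\omega)\xrightarrow{t\to\infty}P(s'\mid s,a).$$ -/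

import Mathlib

open MeasureTheory ProbabilityTheory Filter Topology
open scoped ENNReal unitInterval

/-- A discounted Markov decision process with state space `S` and action space `A`. (The sets of
states and actions are required to be countable where the process is used.) -/
structure DiscountedMDP (S A : Type*) where
  /-- `transition s a s'` is the probability `P(s' | s, a)`. -/
  transition : S → A → PMF S
  reward : S → A → ℝ
  discount : ℝ
  reward_bounded : ∃ C : ℝ, ∀ s a, |reward s a| ≤ C
  discount_mem : discount ∈ Set.Ico (0 : ℝ) 1

/-- Trajectories `((S₀, A₀, S'₀), (S₁, A₁, S'₁), …)`, with the product σ-algebra. -/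
abbrev Trajectory (S A : Type*) : Type _ := ℕ → S × A × S

namespace Trajectory

variable {S A : Type*}

/-- The state `S_t`. -/
def state (t : ℕ) (ω : Trajectory S A) : S := (ω t).1

/-- The action `A_t`. -/
def action (t : ℕ) (ω : Trajectory S A) : A := (ω t).2.1

/-- The successor state `S'_t`. -/
def next (t : ℕ) (ω : Trajectory S A) : S := (ω t).2.2

/-- The times at which the pair `(s, a)` occurs along `ω`. -/
def occurrences (s : S) (a : A) (ω : Trajectory S A) : Set ℕ :=
  {t | state t ω = s ∧ action t ω = a}

open Classical in
/-- The occurrences of `(s, a)` in `[0, t)`. -/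
noncomputable def occurrencesBefore (s : S) (a : A) (ω : Trajectory S A) (t : ℕ) : Finset ℕ :=
  {τ ∈ Finset.range t | τ ∈ occurrences s a ω}

open Classical in
/-- The occurrences of `(s, a)` in the open interval `(t', t)`. -/
noncomputable def occurrencesBetween (s : S) (a : A) (ω : Trajectory S A) (t' t : ℕ) :
    Finset ℕ :=
  {τ ∈ Finset.Ioo t' t | τ ∈ occurrences s a ω}

/-- The σ-algebra generated by `S₀, A₀, S'₀, …, S_{t-1}, A_{t-1}, S'_{t-1}, S_t, A_t`. -/
abbrev history [MeasurableSpace S] [MeasurableSpace A] (t : ℕ) :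
    MeasurableSpace (Trajectory S A) :=
  MeasurableSpace.comap
    (fun ω => ((fun i : Fin t => ω i : Fin t → S × A × S), (state t ω, action t ω)))
    inferInstance

theorem history_le [MeasurableSpace S] [MeasurableSpace A] (t : ℕ) :
    history t ≤ (inferInstance : MeasurableSpace (Trajectory S A)) := by
  refine Measurable.comap_le ?_
  unfold state action
  fun_prop

end Trajectory

namespace DiscountedMDP

open Trajectory

variable {S A : Type*}

/-- `μ` is a trajectory measure on `M`: a probability measure on trajectories under which
`ℙ(S'_t = s' | S₀, A₀, S'₀, …, S_t, A_t) = P(s' | S_t, A_t)` almost surely. -/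
structure IsTrajectoryMeasure [MeasurableSpace S] [MeasurableSpace A] (M : DiscountedMDP S A)
    (μ : Measure (Trajectory S A)) : Prop where
  isProbabilityMeasure : IsProbabilityMeasure μ
  condProb_next : ∀ (t : ℕ) (s' : S),
    μ⟦next t ⁻¹' {s'} | history t⟧ =ᵐ[μ]
      fun ω => (M.transition (state t ω) (action t ω) s').toReal

/-- The trajectory measure `μ` on `M` and the stepsizes `α` satisfy the Robbins–Monro
condition. -/
structure RobbinsMonro [MeasurableSpace S] [MeasurableSpace A] (M : DiscountedMDP S A)
    (μ : Measure (Trajectory S A)) (α : ℕ → I) : Prop where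
  isTrajectoryMeasure : M.IsTrajectoryMeasure μ
  sum_eq_top : ∀ (s : S) (a : A), ∀ᵐ ω ∂μ,
    ∑' t : occurrences s a ω, ENNReal.ofReal (α t : ℝ) = ∞
  sum_sq_lt_top : ∀ (s : S) (a : A), ∀ᵐ ω ∂μ,
    ∑' t : occurrences s a ω, ENNReal.ofReal ((α t : ℝ) ^ 2) < ∞

section ActionReplay

variable (α : ℕ → I) (ω : Trajectory S A)

open Classical in
/-- The action-replay transition weight from `(s, t)` under the action `a`. The state `none` is
the absorbing state, and `some (s', t')` is the replay state `(s', t')`. -/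
noncomputable def replayWeight (s : S) (t : ℕ) (a : A) : Option (S × ℕ) → ℝ
  | none => ∏ τ ∈ occurrencesBefore s a ω t, (1 - (α τ : ℝ))
  | some (s', t') =>
      if t' ∈ occurrencesBefore s a ω t ∧ s' = next t' ω then
        (α t' : ℝ) * ∏ τ ∈ occurrencesBetween s a ω t' t, (1 - (α τ : ℝ))
      else 0

theorem replayWeight_nonneg (s : S) (t : ℕ) (a : A) (x : Option (S × ℕ)) :
    0 ≤ replayWeight α ω s t a x := by
  have h1 : ∀ τ, 0 ≤ 1 - (α τ : ℝ) := fun τ => sub_nonneg.2 (α τ).2.2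
  rcases x with _ | ⟨s', t'⟩
  · exact Finset.prod_nonneg fun τ _ => h1 τ
  · simp only [replayWeight]
    split_ifs
    · exact mul_nonneg (α t').2.1 (Finset.prod_nonneg fun τ _ => h1 τ)
    · exact le_rfl

theorem replayWeight_some {s : S} {t : ℕ} {a : A} {t' : ℕ}
    (h : t' ∈ occurrencesBefore s a ω t) :
    replayWeight α ω s t a (some (next t' ω, t')) =
      (α t' : ℝ) * ∏ τ ∈ occurrencesBetween s a ω t' t, (1 - (α τ : ℝ)) := by
  simp [replayWeight, h]

theorem replayWeight_sum (s : S) (t : ℕ) (a : A) :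
    replayWeight α ω s t a none +
      ∑ t' ∈ occurrencesBefore s a ω t, replayWeight α ω s t a (some (next t' ω, t')) = 1 := by
  rw [Finset.sum_congr (rfl : occurrencesBefore s a ω t = _)
    fun t' h => replayWeight_some α ω h]
  simp only [replayWeight]
  induction t with
  | zero => simp [occurrencesBefore]
  | succ t ih =>
    have hI : ∀ t' < t, Finset.Ioo t' (t + 1) = insert t (Finset.Ioo t' t) := by
      intro t' ht; ext x; simp only [Finset.mem_Ioo, Finset.mem_insert]; omega
    by_cases ht : t ∈ occurrences s a ω
    · have hB : occurrencesBefore s a ω (t + 1) = insert t (occurrencesBefore s a ω t) := by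
        simp [occurrencesBefore, Finset.range_add_one, Finset.filter_insert, ht]
      have hn : t ∉ occurrencesBefore s a ω t := by simp [occurrencesBefore]
      have h0 : occurrencesBetween s a ω t (t + 1) = ∅ := by
        have : Finset.Ioo t (t + 1) = ∅ := by
          ext x; simp only [Finset.mem_Ioo, Finset.notMem_empty, iff_false]; omega
        simp [occurrencesBetween, this]
      have hS : ∀ t' ∈ occurrencesBefore s a ω t,
          (α t' : ℝ) * ∏ τ ∈ occurrencesBetween s a ω t' (t + 1), (1 - (α τ : ℝ)) =
          (1 - (α t : ℝ)) *
            ((α t' : ℝ) * ∏ τ ∈ occurrencesBetween s a ω t' t, (1 - (α τ : ℝ))) := by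
        intro t' h
        have h' : t' < t := by
          have := h; simp only [occurrencesBefore, Finset.mem_filter, Finset.mem_range] at this
          exact this.1
        have : occurrencesBetween s a ω t' (t + 1) =
            insert t (occurrencesBetween s a ω t' t) := by
          simp [occurrencesBetween, hI t' h', Finset.filter_insert, ht]
        rw [this, Finset.prod_insert (by simp [occurrencesBetween])]
        ring
      rw [hB, Finset.prod_insert hn, Finset.sum_insert hn, h0, Finset.sum_congr rfl hS,
        ← Finset.mul_sum, Finset.prod_empty]
      linear_combination (1 - (α t : ℝ)) * ih
    · have hB : occurrencesBefore s a ω (t + 1) = occurrencesBefore s a ω t := by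
        simp [occurrencesBefore, Finset.range_add_one, Finset.filter_insert, ht]
      have hS : ∀ t' ∈ occurrencesBefore s a ω t,
          (α t' : ℝ) * ∏ τ ∈ occurrencesBetween s a ω t' (t + 1), (1 - (α τ : ℝ)) =
          (α t' : ℝ) * ∏ τ ∈ occurrencesBetween s a ω t' t, (1 - (α τ : ℝ)) := by
        intro t' h
        have h' : t' < t := by
          have := h; simp only [occurrencesBefore, Finset.mem_filter, Finset.mem_range] at this
          exact this.1
        have : occurrencesBetween s a ω t' (t + 1) = occurrencesBetween s a ω t' t := by
          simp [occurrencesBetween, hI t' h', Finset.filter_insert, ht]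
        rw [this]
      rw [hB, Finset.sum_congr rfl hS]
      exact ih

open Classical in
/-- The finite set of states reachable in one step from a replay state. -/
noncomputable def replaySupport (s : S) (t : ℕ) (a : A) : Finset (Option (S × ℕ)) :=
  insert none ((occurrencesBefore s a ω t).image fun t' => some (next t' ω, t'))

open Classical in
theorem replayWeight_sum_support (s : S) (t : ℕ) (a : A) :
    ∑ x ∈ replaySupport ω s t a, ENNReal.ofReal (replayWeight α ω s t a x) = 1 := by
  rw [← ENNReal.ofReal_sum_of_nonneg fun x _ => replayWeight_nonneg α ω s t a x]
  rw [replaySupport, Finset.sum_insert (by simp), Finset.sum_image (by simp),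
    replayWeight_sum, ENNReal.ofReal_one]

theorem replayWeight_eq_zero (s : S) (t : ℕ) (a : A) (x : Option (S × ℕ))
    (hx : x ∉ replaySupport ω s t a) : ENNReal.ofReal (replayWeight α ω s t a x) = 0 := by
  rcases x with _ | ⟨s', t'⟩
  · simp [replaySupport] at hx
  · have : ¬ (t' ∈ occurrencesBefore s a ω t ∧ s' = next t' ω) := by
      rintro ⟨h, rfl⟩
      exact hx (by simp [replaySupport, h])
    simp [replayWeight, this]

/-- The transition kernel of the action-replay process. -/
noncomputable def replayTransition : Option (S × ℕ) → A → PMF (Option (S × ℕ))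
  | none, _ => PMF.pure none
  | some (s, t), a =>
      PMF.ofFinset (fun x => ENNReal.ofReal (replayWeight α ω s t a x)) (replaySupport ω s t a)
        (replayWeight_sum_support α ω s t a) (replayWeight_eq_zero α ω s t a)

theorem replayTransition_some_toReal (s : S) (t : ℕ) (a : A) (x : Option (S × ℕ)) :
    (replayTransition α ω (some (s, t)) a x).toReal = replayWeight α ω s t a x := by
  rw [replayTransition, PMF.ofFinset_apply,
    ENNReal.toReal_ofReal (replayWeight_nonneg α ω s t a x)]

/-- The rewards of the action-replay process. -/
noncomputable def replayReward (M : DiscountedMDP S A) : Option (S × ℕ) → A → ℝ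
  | none, _ => 0
  | some (s, t), a =>
      M.reward s a * ∑ t' ∈ occurrencesBefore s a ω t,
        (replayTransition α ω (some (s, t)) a (some (next t' ω, t'))).toReal

theorem replayReward_bounded (M : DiscountedMDP S A) :
    ∃ C : ℝ, ∀ x a, |replayReward α ω M x a| ≤ C := by
  obtain ⟨C, hC⟩ := M.reward_bounded
  refine ⟨max C 0, fun x a => ?_⟩
  rcases x with _ | ⟨s, t⟩
  · simp [replayReward]
  · have h1 := replayWeight_sum α ω s t a
    have h2 := replayWeight_nonneg α ω s t a none
    have h3 : 0 ≤ ∑ t' ∈ occurrencesBefore s a ω t,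
        replayWeight α ω s t a (some (next t' ω, t')) :=
      Finset.sum_nonneg fun t' _ => replayWeight_nonneg α ω s t a _
    simp only [replayReward, replayTransition_some_toReal]
    rw [abs_mul, abs_of_nonneg h3]
    refine le_trans (mul_le_of_le_one_right (abs_nonneg _) (by linarith)) ?_
    exact (hC s a).trans (le_max_left _ _)

/-- The action-replay process of `M` induced by the stepsizes `α` and the trajectory `ω`. -/
noncomputable def actionReplay (M : DiscountedMDP S A) : DiscountedMDP (Option (S × ℕ)) A where
  transition := replayTransition α ω
  reward := replayReward α ω M
  discount := M.discount
  reward_bounded := replayReward_bounded α ω M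
  discount_mem := M.discount_mem

end ActionReplay

end DiscountedMDP

/-!
Fix a pair `(s, a)` and a successor state `s'`, and let `β t` be `α t` if `(s, a)` occurs at time
`t` and `0` otherwise. The absorbing weight from `(s, t)` is `∏ i < t, (1 - β i)`, which tends to
`0` because `∑ β t = ∞`; as the weights sum to `1`, the rewards converge. The total weight `Q t` of
the replay states over `s'` satisfies the exponential-averaging recursion
`Q (t + 1) = (1 - β t) * Q t + β t * 1{S'_t = s'}` (`DiscountedMDP.sum_replayWeight_succ`), so that
`D t = Q t - P(s' | s, a)` is driven by the centred indicators `X t = 1{S'_t = s'} - P(s' | s, a)`.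

Two facts give `D t → 0`.

* The noise series `∑ β t * X t` converges almost surely
  (`DiscountedMDP.ae_exists_tendsto_sum_noise`). Its partial sums are a martingale for the
  histories, with increments bounded by the predictable `β t`. Since `∑ β t ^ 2` is only almost
  surely finite, the increments are truncated once the partial sums of `β t ^ 2` exceed a level `K`;
  the truncated martingale is bounded in `L²` and hence converges, and almost every trajectory is
  unaffected by the truncation for `K` large (`ae_exists_tendsto_sum_of_summable_sq`).
* Deterministically, if `∑ β t * X t` converges and `∑ β t = ∞`, the recursion forces `D t → 0`:
  subtracting the remainder of the convergent series turns the inputs into a null sequence, which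
  the averaging follows (`tendsto_zero_of_robbinsMonro_recursion`).
-/

/-! ### Averaging recursions with divergent stepsizes -/

theorem tendsto_prod_one_sub_of_tendsto_sum_atTop {b : ℕ → ℝ} (h1 : ∀ n, b n ≤ 1)
    (hb : Tendsto (fun n => ∑ i ∈ Finset.range n, b i) atTop atTop) :
    Tendsto (fun n => ∏ i ∈ Finset.range n, (1 - b i)) atTop (𝓝 0) := by
  refine squeeze_zero (fun n => Finset.prod_nonneg fun i _ => sub_nonneg.2 (h1 i)) (fun n => ?_)
    (Real.tendsto_exp_neg_atTop_nhds_zero.comp hb)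
  rw [Function.comp_apply, ← Finset.sum_neg_distrib, Real.exp_sum]
  exact Finset.prod_le_prod (fun i _ => sub_nonneg.2 (h1 i)) fun i _ => Real.one_sub_le_exp_neg _

/-- A convex-combination recursion with divergent stepsizes forgets its initial value and follows
its inputs. -/
theorem tendsto_zero_of_convex_recursion {b c y : ℕ → ℝ} (h0 : ∀ n, 0 ≤ b n) (h1 : ∀ n, b n ≤ 1)
    (hb : Tendsto (fun n => ∑ i ∈ Finset.range n, b i) atTop atTop)
    (hc : Tendsto c atTop (𝓝 0)) (hy : ∀ n, y (n + 1) = (1 - b n) * y n + b n * c n) :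
    Tendsto y atTop (𝓝 0) := by
  rw [Metric.tendsto_atTop] at hc ⊢
  intro ε hε
  obtain ⟨N, hN⟩ := hc (ε / 2) (half_pos hε)
  have hbN : Tendsto (fun n => ∑ i ∈ Finset.range n, b (N + i)) atTop atTop := by
    have := tendsto_atTop_add_const_right atTop (-∑ i ∈ Finset.range N, b i)
      ((tendsto_add_atTop_iff_nat N).2 hb)
    refine this.congr fun n => ?_
    rw [add_comm n N, Finset.sum_range_add]
    ring
  have hle : ∀ n, |y (N + n)| ≤ ε / 2 + |y N| * ∏ i ∈ Finset.range n, (1 - b (N + i)) := by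
    intro n
    induction n with
    | zero => simpa using (half_pos hε).le
    | succ n ih =>
      have hcn : |c (N + n)| ≤ ε / 2 := by
        simpa [Real.dist_eq] using (hN (N + n) (by omega)).le
      have hb1 := sub_nonneg.2 (h1 (N + n))
      rw [← add_assoc, hy, Finset.prod_range_succ]
      calc |(1 - b (N + n)) * y (N + n) + b (N + n) * c (N + n)|
          ≤ (1 - b (N + n)) * |y (N + n)| + b (N + n) * |c (N + n)| := by
            refine (abs_add_le _ _).trans_eq ?_
            rw [abs_mul, abs_mul, abs_of_nonneg hb1, abs_of_nonneg (h0 _)]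
        _ ≤ (1 - b (N + n)) * (ε / 2 + |y N| * ∏ i ∈ Finset.range n, (1 - b (N + i))) +
              b (N + n) * (ε / 2) :=
            add_le_add (mul_le_mul_of_nonneg_left ih hb1)
              (mul_le_mul_of_nonneg_left hcn (h0 _))
        _ = _ := by ring
  have hlim : Tendsto (fun n => |y N| * ∏ i ∈ Finset.range n, (1 - b (N + i))) atTop (𝓝 0) := by
    simpa using (tendsto_prod_one_sub_of_tendsto_sum_atTop (fun n => h1 (N + n)) hbN).const_mul
      |y N|
  obtain ⟨K, hK⟩ := eventually_atTop.1 (hlim.eventually_lt_const (half_pos hε))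
  refine ⟨N + K, fun n hn => ?_⟩
  obtain ⟨k, rfl⟩ := Nat.exists_eq_add_of_le (le_of_add_le_left hn)
  have := hle k
  have := hK k (by omega)
  rw [Real.dist_eq, sub_zero]
  linarith

/-- The deterministic half of the Robbins–Monro argument: averaging annihilates noise whose
weighted partial sums converge. -/
theorem tendsto_zero_of_robbinsMonro_recursion {b x d : ℕ → ℝ} (h0 : ∀ n, 0 ≤ b n)
    (h1 : ∀ n, b n ≤ 1) (hb : Tendsto (fun n => ∑ i ∈ Finset.range n, b i) atTop atTop)
    (hx : ∃ l, Tendsto (fun n => ∑ i ∈ Finset.range n, b i * x i) atTop (𝓝 l))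
    (hd : ∀ n, d (n + 1) = (1 - b n) * d n + b n * x n) :
    Tendsto d atTop (𝓝 0) := by
  obtain ⟨l, hl⟩ := hx
  -- Subtracting the convergent remainder `e` turns the inputs `x` into the null sequence `-e`.
  set e : ℕ → ℝ := fun n => ∑ i ∈ Finset.range n, b i * x i - l with he
  have he0 : Tendsto e atTop (𝓝 0) := by simpa [he] using hl.sub_const l
  have hy : Tendsto (fun n => d n - e n) atTop (𝓝 0) := by
    refine tendsto_zero_of_convex_recursion h0 h1 hb (c := fun n => -e n) (by simpa using he0.neg)
      fun n => ?_
    simp only [he, hd, Finset.sum_range_succ]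
    ring
  simpa using hy.add he0

/-! ### Convergence of martingale sums with square-summable increments -/

section MartingaleSums

variable {Ω : Type*} {m0 : MeasurableSpace Ω} {μ : Measure Ω} [IsProbabilityMeasure μ]
  {ℱ : Filtration ℕ m0} {ξ : ℕ → Ω → ℝ}

theorem martingale_sum_range (hξm : ∀ n, StronglyMeasurable[ℱ (n + 1)] (ξ n))
    (hξi : ∀ n, Integrable (ξ n) μ) (hξ0 : ∀ n, μ[ξ n | ℱ n] =ᵐ[μ] 0) :
    Martingale (fun n => ∑ i ∈ Finset.range n, ξ i) ℱ μ := by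
  have hadp : StronglyAdapted ℱ (fun n => ∑ i ∈ Finset.range n, ξ i) := fun n =>
    Finset.stronglyMeasurable_sum _ fun i hi =>
      (hξm i).mono (ℱ.mono (Finset.mem_range.1 hi))
  have hint : ∀ n, Integrable (∑ i ∈ Finset.range n, ξ i) μ := fun n =>
    integrable_finsetSum' _ fun i _ => hξi i
  refine martingale_nat hadp hint fun n => ?_
  simp only [Finset.sum_range_succ]
  have h := condExp_add (hint n) (hξi n) (ℱ n)
  rw [condExp_of_stronglyMeasurable (ℱ.le n) (hadp n) (hint n)] at h
  filter_upwards [h, hξ0 n] with ω h1 h2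
  rw [h1, Pi.add_apply, h2, Pi.zero_apply, add_zero]

/-- Orthogonality of martingale increments. -/
theorem integral_sq_sum_range (hξm : ∀ n, StronglyMeasurable[ℱ (n + 1)] (ξ n))
    (hξi : ∀ n, MemLp (ξ n) 2 μ) (hξ0 : ∀ n, μ[ξ n | ℱ n] =ᵐ[μ] 0) (n : ℕ) :
    ∫ ω, (∑ i ∈ Finset.range n, ξ i ω) ^ 2 ∂μ = ∑ i ∈ Finset.range n, ∫ ω, ξ i ω ^ 2 ∂μ := by
  have hmem : ∀ n, MemLp (∑ i ∈ Finset.range n, ξ i) 2 μ := fun n =>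
    memLp_finsetSum' _ fun i _ => hξi i
  have hi : ∀ n, Integrable (ξ n) μ := fun n => (hξi n).integrable one_le_two
  have hM := martingale_sum_range hξm hi hξ0
  induction n with
  | zero => simp
  | succ n ih =>
    have hprod := (hmem n).integrable_mul (hξi n)
    have hcross : ∫ ω, ((∑ i ∈ Finset.range n, ξ i) * ξ n) ω ∂μ = 0 := by
      rw [← integral_condExp (ℱ.le n)]
      refine integral_eq_zero_of_ae ?_
      filter_upwards [condExp_mul_of_stronglyMeasurable_left (hM.1 n) hprod (hi n), hξ0 n]
        with ω h1 h2
      rw [h1, Pi.mul_apply, h2]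
      simp
    have hexp : ∀ ω, (∑ i ∈ Finset.range (n + 1), ξ i ω) ^ 2 =
        (∑ i ∈ Finset.range n, ξ i ω) ^ 2 +
          (2 * ((∑ i ∈ Finset.range n, ξ i) * ξ n) ω + ξ n ω ^ 2) := by
      intro ω
      rw [Finset.sum_range_succ, Pi.mul_apply, Finset.sum_apply]
      ring
    have hsq : Integrable (fun ω => (∑ i ∈ Finset.range n, ξ i ω) ^ 2) μ := by
      simpa using (hmem n).integrable_sq
    have hrest : Integrable
        (fun ω => 2 * ((∑ i ∈ Finset.range n, ξ i) * ξ n) ω + ξ n ω ^ 2) μ :=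
      (hprod.const_mul 2).add (hξi n).integrable_sq
    simp only [hexp]
    rw [integral_add hsq hrest,
      integral_add (hprod.const_mul 2) (hξi n).integrable_sq, integral_const_mul, hcross, ih,
      Finset.sum_range_succ, mul_zero, zero_add]

/-- Martingales bounded in `L²` converge almost surely. -/
theorem ae_exists_tendsto_sum_of_integral_sq_le
    (hξm : ∀ n, StronglyMeasurable[ℱ (n + 1)] (ξ n)) (hξi : ∀ n, MemLp (ξ n) 2 μ)
    (hξ0 : ∀ n, μ[ξ n | ℱ n] =ᵐ[μ] 0) {K : ℝ}
    (hK : ∀ n, ∑ i ∈ Finset.range n, ∫ ω, ξ i ω ^ 2 ∂μ ≤ K) :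
    ∀ᵐ ω ∂μ, ∃ l, Tendsto (fun n => ∑ i ∈ Finset.range n, ξ i ω) atTop (𝓝 l) := by
  have hM := martingale_sum_range hξm (fun n => (hξi n).integrable one_le_two) hξ0
  have hmem : ∀ n, MemLp (∑ i ∈ Finset.range n, ξ i) 2 μ := fun n =>
    memLp_finsetSum' _ fun i _ => hξi i
  have hbdd : ∀ n, eLpNorm (∑ i ∈ Finset.range n, ξ i) 1 μ ≤ (1 + K).toNNReal := by
    intro n
    rw [eLpNorm_one_eq_lintegral_enorm, ← ofReal_integral_norm_eq_lintegral_enorm (hM.integrable n)]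
    refine ENNReal.ofReal_le_ofReal ?_
    calc ∫ ω, ‖(∑ i ∈ Finset.range n, ξ i) ω‖ ∂μ
        ≤ ∫ ω, (1 + (∑ i ∈ Finset.range n, ξ i) ω ^ 2) ∂μ := by
          refine integral_mono (hM.integrable n).norm
            ((integrable_const 1).add (hmem n).integrable_sq) fun ω => ?_
          have := sq_abs ((∑ i ∈ Finset.range n, ξ i) ω)
          simp only [Real.norm_eq_abs]
          nlinarith [sq_nonneg (|(∑ i ∈ Finset.range n, ξ i) ω| - 1)]
      _ = 1 + ∑ i ∈ Finset.range n, ∫ ω, ξ i ω ^ 2 ∂μ := by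
          rw [integral_add (integrable_const 1) (hmem n).integrable_sq,
            ← integral_sq_sum_range hξm hξi hξ0]
          simp
      _ ≤ 1 + K := by linarith [hK n]
  simpa using hM.submartingale.exists_ae_tendsto_of_bdd hbdd

/-- Martingale sums converge almost surely when their increments are dominated by a predictable,
almost surely square-summable sequence. No bound on the expectation of `∑ b n ^ 2` is assumed: the
increments are switched off once the partial sums of `b n ^ 2` exceed a level `K`, and every
trajectory stays below some `K`. -/
theorem ae_exists_tendsto_sum_of_summable_sq {b : ℕ → Ω → ℝ}
    (hξm : ∀ n, StronglyMeasurable[ℱ (n + 1)] (ξ n)) (hξi : ∀ n, Integrable (ξ n) μ)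
    (hξ0 : ∀ n, μ[ξ n | ℱ n] =ᵐ[μ] 0) (hbm : ∀ n, StronglyMeasurable[ℱ n] (b n))
    (hξb : ∀ n ω, |ξ n ω| ≤ b n ω) (hb : ∀ᵐ ω ∂μ, Summable fun n => b n ω ^ 2) :
    ∀ᵐ ω ∂μ, ∃ l, Tendsto (fun n => ∑ i ∈ Finset.range n, ξ i ω) atTop (𝓝 l) := by
  let s : ℕ → ℕ → Set Ω := fun K n => {ω | ∑ i ∈ Finset.range (n + 1), b i ω ^ 2 ≤ K}
  have hs : ∀ K n, MeasurableSet[ℱ n] (s K n) := by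
    intro K n
    have : Measurable[ℱ n] fun ω => ∑ i ∈ Finset.range (n + 1), b i ω ^ 2 :=
      Finset.measurable_sum _ fun i hi => (((hbm i).mono
        (ℱ.mono (Nat.lt_succ_iff.1 (Finset.mem_range.1 hi)))).measurable.pow_const 2)
    exact this measurableSet_Iic
  have hsum : ∀ K n ω, ∑ i ∈ Finset.range n, (s K i).indicator (ξ i) ω ^ 2 ≤ K := by
    intro K n ω
    induction n with
    | zero => simp
    | succ n ih =>
      rw [Finset.sum_range_succ]
      by_cases hω : ω ∈ s K n
      · refine le_trans ?_ hω
        rw [← Finset.sum_range_succ]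
        refine Finset.sum_le_sum fun i _ => ?_
        refine (sq_le_sq' ?_ ?_)
        all_goals
          have h1 := abs_le.1 (hξb i ω)
          have h2 := (abs_nonneg _).trans (hξb i ω)
          by_cases hi : ω ∈ s K i <;> simp only [hi, Set.indicator_of_mem, Set.indicator_of_notMem,
            not_false_eq_true] <;> linarith
      · simpa [hω] using ih
  have hconv : ∀ K : ℕ, ∀ᵐ ω ∂μ, ∃ l,
      Tendsto (fun n => ∑ i ∈ Finset.range n, (s K i).indicator (ξ i) ω) atTop (𝓝 l) := by
    intro K
    have hm : ∀ n, StronglyMeasurable[ℱ (n + 1)] ((s K n).indicator (ξ n)) := fun n =>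
      (hξm n).indicator (ℱ.mono n.le_succ _ (hs K n))
    have hmem : ∀ n, MemLp ((s K n).indicator (ξ n)) 2 μ := by
      intro n
      refine MemLp.of_bound ((hm n).mono (ℱ.le _)).aestronglyMeasurable (√K) (ae_of_all _ fun ω => ?_)
      refine Real.abs_le_sqrt (le_trans ?_ (hsum K (n + 1) ω))
      exact Finset.single_le_sum (f := fun i => (s K i).indicator (ξ i) ω ^ 2)
        (fun i _ => sq_nonneg _) (Finset.self_mem_range_succ n)
    refine ae_exists_tendsto_sum_of_integral_sq_le (ℱ := ℱ) hm hmem (fun n => ?_) (K := K)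
      fun n => ?_
    · filter_upwards [condExp_indicator (hξi n) (hs K n), hξ0 n] with ω h1 h2
      rw [h1]
      by_cases hω : ω ∈ s K n <;> simp [hω, h2]
    · rw [← integral_finsetSum _ fun i _ => (hmem i).integrable_sq]
      calc ∫ ω, ∑ i ∈ Finset.range n, (s K i).indicator (ξ i) ω ^ 2 ∂μ
          ≤ ∫ _, (K : ℝ) ∂μ :=
            integral_mono (integrable_finsetSum _ fun i _ => (hmem i).integrable_sq)
              (integrable_const _) fun ω => hsum K n ω
        _ = K := by simp
  filter_upwards [hb, ae_all_iff.2 hconv] with ω h1 h2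
  obtain ⟨K, hK⟩ := exists_nat_ge (∑' n, b n ω ^ 2)
  obtain ⟨l, hl⟩ := h2 K
  refine ⟨l, hl.congr fun n => Finset.sum_congr rfl fun i _ => Set.indicator_of_mem ?_ _⟩
  exact (h1.sum_le_tsum _ fun i _ => sq_nonneg _).trans hK

end MartingaleSums

/-! ### The update recursion of action-replay transition weights -/

namespace DiscountedMDP

open Trajectory

variable {S A : Type*}

open Classical in
/-- The stepsize used at time `t` for the pair `(s, a)`: it is `α t` if the pair occurs at time
`t`, and `0` otherwise. -/
noncomputable def pairStepsize (α : ℕ → I) (s : S) (a : A) (t : ℕ) (ω : Trajectory S A) : ℝ :=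
  if t ∈ occurrences s a ω then (α t : ℝ) else 0

section Replay

variable (α : ℕ → I) (ω : Trajectory S A) (s : S) (a : A)

theorem pairStepsize_nonneg (t : ℕ) : 0 ≤ pairStepsize α s a t ω := by
  unfold pairStepsize
  split_ifs
  exacts [(α t).2.1, le_rfl]

theorem pairStepsize_le_one (t : ℕ) : pairStepsize α s a t ω ≤ 1 := by
  unfold pairStepsize
  split_ifs
  exacts [(α t).2.2, zero_le_one]

theorem pairStepsize_eq_indicator (t : ℕ) :
    pairStepsize α s a t ω = (occurrences s a ω).indicator (fun t => (α t : ℝ)) t := by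
  classical simp [pairStepsize, Set.indicator_apply]

theorem replayWeight_none (t : ℕ) :
    replayWeight α ω s t a none = ∏ τ ∈ Finset.range t, (1 - pairStepsize α s a τ ω) := by
  classical
  simp only [replayWeight, occurrencesBefore, Finset.prod_filter]
  refine Finset.prod_congr rfl fun τ _ => ?_
  unfold pairStepsize
  split_ifs <;> simp

theorem replayWeight_some_succ {t t' : ℕ} (ht : t' < t) (s' : S) :
    replayWeight α ω s (t + 1) a (some (s', t')) =
      (1 - pairStepsize α s a t ω) * replayWeight α ω s t a (some (s', t')) := by
  classical
  have hmem : t' ∈ occurrencesBefore s a ω (t + 1) ↔ t' ∈ occurrencesBefore s a ω t := by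
    simp [occurrencesBefore, ht, ht.trans t.lt_succ_self]
  have hI : Finset.Ioo t' (t + 1) = insert t (Finset.Ioo t' t) := by
    ext x; simp only [Finset.mem_Ioo, Finset.mem_insert]; omega
  simp only [replayWeight, hmem]
  split_ifs with h
  · simp only [occurrencesBetween, Finset.prod_filter, hI]
    rw [Finset.prod_insert (by simp)]
    unfold pairStepsize
    split_ifs <;> ring
  · rw [mul_zero]

theorem replayWeight_some_self (t : ℕ) (s' : S) :
    replayWeight α ω s (t + 1) a (some (s', t)) =
      pairStepsize α s a t ω * (next t ⁻¹' {s'}).indicator (fun _ => (1 : ℝ)) ω := by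
  classical
  have h0 : occurrencesBetween s a ω t (t + 1) = ∅ := by
    simp only [occurrencesBetween, Finset.filter_eq_empty_iff, Finset.mem_Ioo]
    omega
  by_cases h1 : t ∈ occurrences s a ω <;> by_cases h2 : s' = next t ω <;>
    simp [replayWeight, pairStepsize, occurrencesBefore, h0, h1, h2, eq_comm (b := s')]

/-- The sum over the occurrences of `(s, a)` may run over all times before `t`, since the weight
vanishes at all other times. -/
theorem sum_replayWeight_occurrencesBefore (t : ℕ) (s' : S) :
    ∑ t' ∈ occurrencesBefore s a ω t, replayWeight α ω s t a (some (s', t')) =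
      ∑ t' ∈ Finset.range t, replayWeight α ω s t a (some (s', t')) := by
  classical
  refine Finset.sum_subset (by simp [occurrencesBefore]) fun t' _ h => ?_
  simp [replayWeight, h]

/-- The total replay weight of the successor state `s'` is an exponential average of the indicators
of `S'_t = s'` along the occurrences of `(s, a)`. -/
theorem sum_replayWeight_succ (t : ℕ) (s' : S) :
    ∑ t' ∈ Finset.range (t + 1), replayWeight α ω s (t + 1) a (some (s', t')) =
      (1 - pairStepsize α s a t ω) *
          ∑ t' ∈ Finset.range t, replayWeight α ω s t a (some (s', t')) +
        pairStepsize α s a t ω * (next t ⁻¹' {s'}).indicator (fun _ => (1 : ℝ)) ω := by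
  rw [Finset.sum_range_succ, replayWeight_some_self, Finset.mul_sum]
  congr 1
  exact Finset.sum_congr rfl fun t' h => replayWeight_some_succ α ω s a (Finset.mem_range.1 h) s'

variable {α ω s a}

theorem tendsto_sum_pairStepsize_atTop
    (h : ∑' t : occurrences s a ω, ENNReal.ofReal (α t : ℝ) = ∞) :
    Tendsto (fun n => ∑ i ∈ Finset.range n, pairStepsize α s a i ω) atTop atTop := by
  rw [← not_summable_iff_tendsto_nat_atTop_of_nonneg (pairStepsize_nonneg α ω s a)]
  intro hs
  simp only [pairStepsize_eq_indicator] at hs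
  exact (summable_subtype_iff_indicator.2 hs).tsum_ofReal_ne_top h

theorem summable_sq_pairStepsize
    (h : ∑' t : occurrences s a ω, ENNReal.ofReal ((α t : ℝ) ^ 2) < ∞) :
    Summable fun t => pairStepsize α s a t ω ^ 2 := by
  have h1 := ENNReal.summable_toReal h.ne
  simp only [ENNReal.toReal_ofReal (sq_nonneg _)] at h1
  refine (summable_subtype_iff_indicator (f := fun t => (α t : ℝ) ^ 2).1 h1).congr fun t => ?_
  classical
  by_cases ht : t ∈ occurrences s a ω <;> simp [pairStepsize, ht]

end Replay

/-! ### The noise along the occurrences of a pair -/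

section Noise

variable [MeasurableSpace S] [MeasurableSpace A]

variable (S A) in
/-- The filtration of the histories `S₀, A₀, S'₀, …, S_{t-1}, A_{t-1}, S'_{t-1}, S_t, A_t`. -/
def historyFiltration : Filtration ℕ (inferInstance : MeasurableSpace (Trajectory S A)) where
  seq := history
  mono' := by
    refine monotone_nat_of_le_succ fun t => ?_
    -- The history at `t` is a function of the triples at times `0, …, t`.
    have hφ : Measurable fun x : (Fin (t + 1) → S × A × S) × (S × A) =>
        ((fun i : Fin t => x.1 i.castSucc), ((x.1 (Fin.last t)).1, (x.1 (Fin.last t)).2.1)) := by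
      fun_prop
    refine le_trans (le_of_eq ?_) (MeasurableSpace.comap_mono hφ.comap_le)
    rw [MeasurableSpace.comap_comp]
    rfl
  le' := history_le

theorem measurable_history_apply (t : ℕ) :
    Measurable[history (t + 1)] fun ω : Trajectory S A => ω t :=
  (measurable_pi_apply (Fin.last t)).comp
    (measurable_fst.comp (comap_measurable fun ω : Trajectory S A =>
      ((fun i : Fin (t + 1) => ω i : Fin (t + 1) → S × A × S),
        (state (t + 1) ω, action (t + 1) ω))))

theorem stronglyMeasurable_indicator_next [DiscreteMeasurableSpace S] (t : ℕ) (s' : S) :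
    StronglyMeasurable[history (t + 1)]
      ((next t ⁻¹' {s'} : Set (Trajectory S A)).indicator fun _ => (1 : ℝ)) := by
  refine stronglyMeasurable_const.indicator ?_
  exact (measurable_snd.comp (measurable_snd.comp (measurable_history_apply t)))
    (measurableSet_singleton s')

variable [DiscreteMeasurableSpace S] [DiscreteMeasurableSpace A]

theorem stronglyMeasurable_pairStepsize (α : ℕ → I) (s : S) (a : A) (t : ℕ) :
    StronglyMeasurable[history t] (pairStepsize α s a t) := by
  classical
  have hm : Measurable[history t] fun ω : Trajectory S A => (state t ω, action t ω) :=
    measurable_snd.comp (comap_measurable fun ω : Trajectory S A =>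
      ((fun i : Fin t => ω i : Fin t → S × A × S), (state t ω, action t ω)))
  have hs : MeasurableSet[history t] {ω : Trajectory S A | t ∈ occurrences s a ω} := by
    have := hm ((measurableSet_singleton s).prod (measurableSet_singleton a))
    convert this using 1
    ext ω
    simp [occurrences]
  exact (Measurable.ite hs measurable_const measurable_const).stronglyMeasurable

/-- Given the history, the deviation of the indicator of `S'_t = s'` from `P(s' | s, a)`, scaled by
the stepsize of `(s, a)`, has mean zero. -/
theorem condExp_pairStepsize_mul {M : DiscountedMDP S A} {μ : Measure (Trajectory S A)}
    (h : M.IsTrajectoryMeasure μ) (α : ℕ → I) (s : S) (a : A) (s' : S) (t : ℕ) :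
    μ[fun ω => pairStepsize α s a t ω *
      ((next t ⁻¹' {s'}).indicator (fun _ => (1 : ℝ)) ω - (M.transition s a s').toReal) |
        history t] =ᵐ[μ] 0 := by
  have := h.isProbabilityMeasure
  have hind : Integrable ((next t ⁻¹' {s'} : Set (Trajectory S A)).indicator fun _ => (1 : ℝ)) μ :=
    (integrable_const 1).indicator (measurableSet_preimage
      (by unfold next; fun_prop) (measurableSet_singleton s'))
  have hdev := hind.sub (integrable_const (μ := μ) (M.transition s a s').toReal)
  have hb := stronglyMeasurable_pairStepsize α s a t
  have hpull := condExp_stronglyMeasurable_mul_of_bound (history_le t) hb hdev 1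
    (ae_of_all _ fun ω => by
      rw [Real.norm_eq_abs, abs_of_nonneg (pairStepsize_nonneg α ω s a t)]
      exact pairStepsize_le_one α ω s a t)
  refine EventuallyEq.trans hpull ?_
  filter_upwards [condExp_sub hind (integrable_const (μ := μ) (M.transition s a s').toReal)
    (history t), h.condProb_next t s'] with ω h1 h2
  rw [Pi.mul_apply, h1, Pi.sub_apply, h2, condExp_const (history_le t)]
  classical
  by_cases ht : t ∈ occurrences s a ω
  · simp [ht.1, ht.2]
  · simp [pairStepsize, ht]

theorem ae_exists_tendsto_sum_noise {M : DiscountedMDP S A} {μ : Measure (Trajectory S A)}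
    {α : ℕ → I} (h : M.RobbinsMonro μ α) (s : S) (a : A) (s' : S) :
    ∀ᵐ ω ∂μ, ∃ l, Tendsto (fun n => ∑ i ∈ Finset.range n, pairStepsize α s a i ω *
      ((next i ⁻¹' {s'}).indicator (fun _ => (1 : ℝ)) ω - (M.transition s a s').toReal))
        atTop (𝓝 l) := by
  have := h.isTrajectoryMeasure.isProbabilityMeasure
  have hp : (M.transition s a s').toReal ∈ Set.Icc (0 : ℝ) 1 :=
    ⟨ENNReal.toReal_nonneg, ENNReal.toReal_le_of_le_ofReal zero_le_one
      (by simpa using PMF.coe_le_one _ _)⟩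
  have hbound : ∀ (t : ℕ) (ω : Trajectory S A), |pairStepsize α s a t ω *
      ((next t ⁻¹' {s'}).indicator (fun _ => (1 : ℝ)) ω - (M.transition s a s').toReal)| ≤
        pairStepsize α s a t ω := by
    intro t ω
    rw [abs_mul, abs_of_nonneg (pairStepsize_nonneg α ω s a t)]
    refine mul_le_of_le_one_right (pairStepsize_nonneg α ω s a t) (abs_le.2 ?_)
    classical
    obtain ⟨h0, h1⟩ := hp
    by_cases hs : next t ω = s' <;> constructor <;> simp [hs] <;> linarith
  have hm : ∀ t, StronglyMeasurable[historyFiltration S A (t + 1)] fun ω : Trajectory S A =>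
      pairStepsize α s a t ω *
        ((next t ⁻¹' {s'}).indicator (fun _ => (1 : ℝ)) ω - (M.transition s a s').toReal) :=
    fun t => ((stronglyMeasurable_pairStepsize α s a t).mono
      ((historyFiltration S A).mono t.le_succ)).mul
        ((stronglyMeasurable_indicator_next t s').sub stronglyMeasurable_const)
  refine ae_exists_tendsto_sum_of_summable_sq (ℱ := historyFiltration S A)
    (b := pairStepsize α s a) hm (fun t => ?_)
    (fun t => condExp_pairStepsize_mul h.isTrajectoryMeasure α s a s' t)
    (stronglyMeasurable_pairStepsize α s a) hbound ?_
  · exact Integrable.of_bound ((hm t).mono ((historyFiltration S A).le _)).aestronglyMeasurable 1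
      (ae_of_all _ fun ω => (hbound t ω).trans (pairStepsize_le_one α ω s a t))
  · filter_upwards [h.sum_sq_lt_top s a] with ω hω using summable_sq_pairStepsize hω

end Noise

end DiscountedMDP

/-! ### Convergence of the action-replay process -/

open DiscountedMDP in
theorem mainTheorem3 {S A : Type*}
    [Countable S] [MeasurableSpace S] [DiscreteMeasurableSpace S]
    [Countable A] [MeasurableSpace A] [DiscreteMeasurableSpace A]
    (M : DiscountedMDP S A) (μ : Measure (Trajectory S A)) (α : ℕ → I)
    (h : M.RobbinsMonro μ α) :
    ∀ᵐ ω ∂μ, ∀ (s : S) (a : A) (s' : S),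
      Tendsto (fun t : ℕ => (M.actionReplay α ω).reward (some (s, t)) a) atTop
        (𝓝 (M.reward s a)) ∧
      Tendsto
        (fun t : ℕ => ∑ t' ∈ Trajectory.occurrencesBefore s a ω t,
          ((M.actionReplay α ω).transition (some (s, t)) a (some (s', t'))).toReal)
        atTop (𝓝 (M.transition s a s').toReal) := by
  simp only [ae_all_iff]
  intro s a s'
  filter_upwards [h.sum_eq_top s a, ae_exists_tendsto_sum_noise h s a s'] with ω htop hnoise
  have hb := tendsto_sum_pairStepsize_atTop htop
  have habsorb : Tendsto (fun t => replayWeight α ω s t a none) atTop (𝓝 0) := by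
    simp only [replayWeight_none]
    exact tendsto_prod_one_sub_of_tendsto_sum_atTop (pairStepsize_le_one α ω s a) hb
  simp only [actionReplay, replayReward, replayTransition_some_toReal]
  constructor
  · have hsum : ∀ t, ∑ t' ∈ Trajectory.occurrencesBefore s a ω t,
        replayWeight α ω s t a (some (Trajectory.next t' ω, t')) =
          1 - replayWeight α ω s t a none := fun t =>
      eq_sub_of_add_eq' (replayWeight_sum α ω s t a)
    simp only [hsum]
    simpa using (habsorb.const_sub 1).const_mul (M.reward s a)
  · simp only [sum_replayWeight_occurrencesBefore]
    refine tendsto_sub_nhds_zero_iff.1 (tendsto_zero_of_robbinsMonro_recursion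
      (pairStepsize_nonneg α ω s a) (pairStepsize_le_one α ω s a) hb hnoise fun t => ?_)
    rw [sum_replayWeight_succ]
    ring
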